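/- Let $R=\mathbb{Z}[\beta][x_1,x_2,\dotsc]$, let $s_i$ act on $R$ by exchanging $x_i$ and $x_{i+1}$, and define the operators $\partial_i(f)=\dfrac{f-s_i f}{x_i-x_{i+1}}$, $\partial^{(\beta)}_i(f)=\partial_i\big((1+\beta x_{i+1})f\big)$ and $\pi^{(\beta)}_i(f)=\partial^{(\beta)}_i(x_i f)$ on $R$. They satisfy the braid relations, so $\pi^{(\beta)}_v=\pi^{(\beta)}_{i_1}\dotsm\pi^{(\beta)}_{i_\ell}$ is well defined for a permutation $v$ with reduced word $s_{i_1}\dotsm s_{i_\ell}$. Let $w_0=w_0^{(n)}\in S_n$ be the long element. The $\beta$-Grothendieck polynomials $\mathfrak{G}^{(\beta)}_w\in R$, $w\in S_n$, are defined by $\mathfrak{G}^{(\beta)}_{w_0}=x_1^{n-1}x_2^{n-2}\dotsm x_{n-1}$ and $\mathfrak{G}^{(\beta)}_w=\partial^{(\beta)}_i\,\mathfrak{G}^{(\beta)}_{ws_i}$ whenever $\ell(ws_i)>\ell(w)$. For $w\in S_n$ let $1^N\times w\in S_{N+n}$ be the permutation obtained by adding $N$ fixed points before $w$. Then for every $w\in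 S_n$ the limit $$G^{(\beta)}_w=\lim_{N\to\infty}\mathfrak{G}^{(\beta)}_{1^N\times w}$$ exists in $\mathbb{Z}[\beta][[x_1,x_2,\dotsc]]$, in the sense that the coefficient of each monomial in the variables $x_i$ is eventually constant (this limit is the $\beta$-Grothendieck symmetric function), and $$\pi^{(\beta)}_{w_0}\big(\mathfrak{G}^{(\beta)}_w\big)=G^{(\beta)}_w(x_1,\dotsc,x_n),$$ where the right side is $G^{(\beta)}_w$ with $x_i$ set to $0$ for all $i>n$. -/

import Mathlib

namespace Groth

open MvPolynomial

/-- The ring `ℤ[β][x₁, x₂, …]`. The variable `x_{i+1}` is `X i`: all indices start at `0`. -/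
abbrev R : Type := MvPolynomial ℕ (Polynomial ℤ)

/-- The parameter `β`, as an element of the coefficient ring. -/
noncomputable def β : Polynomial ℤ := Polynomial.X

/-- The simple transposition `s_i`, acting on polynomials by exchanging `X i` and `X (i + 1)`. -/
noncomputable def sAct (i : ℕ) : R →ₐ[Polynomial ℤ] R := rename (Equiv.swap i (i + 1))

theorem X_sub_X_dvd (i : ℕ) (f : R) : (X i - X (i + 1) : R) ∣ f - sAct i f := by
  rw [← Ideal.mem_span_singleton, ← Ideal.Quotient.eq_zero_iff_mem, map_sub, sub_eq_zero]
  have hx : Ideal.Quotient.mk (Ideal.span {(X i - X (i + 1) : R)}) (X i)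
      = Ideal.Quotient.mk (Ideal.span {(X i - X (i + 1) : R)}) (X (i + 1)) := by
    rw [Ideal.Quotient.mk_eq_mk_iff_sub_mem]
    exact Ideal.mem_span_singleton_self _
  have h : (Ideal.Quotient.mkₐ (Polynomial ℤ) (Ideal.span {(X i - X (i + 1) : R)}))
      = (Ideal.Quotient.mkₐ (Polynomial ℤ) (Ideal.span {(X i - X (i + 1) : R)})).comp
          (sAct i) := by
    apply MvPolynomial.algHom_ext
    intro k
    simp only [AlgHom.comp_apply, sAct, rename_X, Ideal.Quotient.mkₐ_eq_mk]
    rw [Equiv.swap_apply_def]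
    split_ifs with h1 h2
    · rw [h1, hx]
    · rw [h2, hx]
    · rfl
  exact DFunLike.congr_fun h f

/-- The divided difference `∂_i = (x_i - x_{i+1})⁻¹ (1 - s_i)`. -/
noncomputable def divDiff (i : ℕ) (f : R) : R := (X_sub_X_dvd i f).choose

theorem mul_divDiff (i : ℕ) (f : R) :
    (X i - X (i + 1)) * divDiff i f = f - sAct i f :=
  (X_sub_X_dvd i f).choose_spec.symm

/-- `∂^{(β)}_i = ∂_i (1 + β x_{i+1})`. -/
noncomputable def divDiffB (i : ℕ) (f : R) : R := divDiff i ((1 + C β * X (i + 1)) * f)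

/-- `π^{(β)}_i = ∂^{(β)}_i x_i`. -/
noncomputable def piB (i : ℕ) (f : R) : R := divDiffB i (X i * f)

/-- The simple transposition of `i` and `i + 1` in the symmetric group of `Fin n`
(it is the identity for `i + 1 ≥ n`, where there is none). -/
def sPerm (n i : ℕ) : Equiv.Perm (Fin n) :=
  if h : i + 1 < n then Equiv.swap ⟨i, Nat.lt_of_succ_lt h⟩ ⟨i + 1, h⟩ else 1

/-- The set of inversions of a permutation. -/
def inversions {n : ℕ} (w : Equiv.Perm (Fin n)) : Finset (Fin n × Fin n) :=
  Finset.univ.filter fun p => p.1 < p.2 ∧ w p.2 < w p.1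

/-- The Coxeter length of a permutation: its number of inversions. -/
def length {n : ℕ} (w : Equiv.Perm (Fin n)) : ℕ := (inversions w).card

open Classical in
/-- For a family of operators `T_i` the operator `T_w = T_{i_1} ⋯ T_{i_ℓ}`, where
`w = s_{i_1} ⋯ s_{i_ℓ}` is a reduced word, built by `T_w = T_i T_{s_i w}` for the first `i` with
`s_i w < w`. If the `T_i` satisfy the braid relations, then any such `i` may be used: see
`opPerm_eq`. -/
noncomputable def opPerm {n : ℕ} (T : ℕ → R → R) (w : Equiv.Perm (Fin n)) (f : R) : R :=
  if h : ∃ i, length (sPerm n i * w) < length w then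
    T (Nat.find h) (opPerm T (sPerm n (Nat.find h) * w) f)
  else f
termination_by length w
decreasing_by exact Nat.find_spec h

/-- The long element of the symmetric group of `Fin n`. -/
def longElt (n : ℕ) : Equiv.Perm (Fin n) := Fin.revPerm

/-- The monomial `x^ρ` for `ρ = (n - 1, n - 2, …, 1, 0)`. -/
noncomputable def xRho (n : ℕ) : R := ∏ i ∈ Finset.range n, X i ^ (n - 1 - i)

/-- The `β`-Grothendieck polynomial of `w`. It is determined by the value `x^ρ` at the long
element and by the recursion `𝔊_w = ∂^{(β)}_i 𝔊_{w s_i}` whenever `w s_i > w`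
(see `groth_longElt` and `groth_eq`). -/
noncomputable def groth {n : ℕ} (w : Equiv.Perm (Fin n)) : R :=
  opPerm divDiffB (w⁻¹ * longElt n) (xRho n)

/-! ### The operators are well defined -/

theorem sPerm_of_lt {n i : ℕ} (h : i + 1 < n) :
    sPerm n i = Equiv.swap ⟨i, Nat.lt_of_succ_lt h⟩ ⟨i + 1, h⟩ := dif_pos h

theorem mem_inversions {n : ℕ} (w : Equiv.Perm (Fin n)) (a b : Fin n) :
    (a, b) ∈ inversions w ↔ a < b ∧ w b < w a := by
  simp [inversions]

theorem length_sPerm_mul_lt_iff {n : ℕ} (w : Equiv.Perm (Fin n)) (i : ℕ) :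
    length (sPerm n i * w) < length w ↔
      ∃ h : i + 1 < n, w⁻¹ ⟨i + 1, h⟩ < w⁻¹ ⟨i, Nat.lt_of_succ_lt h⟩ := by
  by_cases h : i + 1 < n
  · rw [sPerm_of_lt h]
    simp only [h, exists_true_left]
    have key : ∀ x y : Fin n, ¬ (x.1 = i ∧ y.1 = i + 1) → ¬ (x.1 = i + 1 ∧ y.1 = i) →
        (Equiv.swap (⟨i, Nat.lt_of_succ_lt h⟩ : Fin n) ⟨i + 1, h⟩ x
          < Equiv.swap (⟨i, Nat.lt_of_succ_lt h⟩ : Fin n) ⟨i + 1, h⟩ y ↔ x < y) := by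
      intro x y h1 h2
      simp only [Equiv.swap_apply_def, Fin.ext_iff]
      split_ifs <;> simp only [Fin.lt_def] <;> omega
    constructor
    · intro hl
      by_contra hc
      refine absurd hl (not_lt.mpr (Finset.card_le_card ?_))
      rintro ⟨a, b⟩ hab
      rw [mem_inversions] at hab
      rw [mem_inversions, Equiv.Perm.mul_apply, Equiv.Perm.mul_apply]
      refine ⟨hab.1, (key _ _ ?_ ?_).mpr hab.2⟩
      · rintro ⟨h1, h2⟩
        apply hc
        have e1 : w⁻¹ ⟨i, Nat.lt_of_succ_lt h⟩ = b := by
          rw [Equiv.Perm.inv_eq_iff_eq]; exact Fin.ext h1.symm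
        have e2 : w⁻¹ ⟨i + 1, h⟩ = a := by
          rw [Equiv.Perm.inv_eq_iff_eq]; exact Fin.ext h2.symm
        rw [e1, e2]; exact hab.1
      · rintro ⟨h1, h2⟩
        have := hab.2
        rw [Fin.lt_def] at this
        omega
    · intro hv
      refine Finset.card_lt_card (Finset.ssubset_iff_subset_ne.mpr ⟨?_, ?_⟩)
      · rintro ⟨a, b⟩ hab
        rw [mem_inversions, Equiv.Perm.mul_apply, Equiv.Perm.mul_apply] at hab
        rw [mem_inversions]
        refine ⟨hab.1, ?_⟩
        by_cases c1 : (w b).1 = i ∧ (w a).1 = i + 1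
        · rw [Fin.lt_def]; omega
        by_cases c2 : (w b).1 = i + 1 ∧ (w a).1 = i
        · exfalso
          have e1 : w⁻¹ ⟨i, Nat.lt_of_succ_lt h⟩ = a := by
            rw [Equiv.Perm.inv_eq_iff_eq]; exact Fin.ext c2.2.symm
          have e2 : w⁻¹ ⟨i + 1, h⟩ = b := by
            rw [Equiv.Perm.inv_eq_iff_eq]; exact Fin.ext c2.1.symm
          rw [e1, e2] at hv
          exact absurd hv (not_lt.mpr hab.1.le)
        · exact (key _ _ c1 c2).mp hab.2
      · intro he
        have hm : (w⁻¹ ⟨i + 1, h⟩, w⁻¹ ⟨i, Nat.lt_of_succ_lt h⟩) ∈ inversions w := by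
          rw [mem_inversions]
          refine ⟨hv, ?_⟩
          rw [Equiv.Perm.coe_inv, Equiv.apply_symm_apply, Equiv.apply_symm_apply, Fin.lt_def]
          exact Nat.lt_succ_self i
        rw [← he, mem_inversions] at hm
        have h2 := hm.2
        rw [Equiv.Perm.mul_apply, Equiv.Perm.mul_apply, Equiv.Perm.coe_inv, Equiv.apply_symm_apply,
          Equiv.apply_symm_apply, Equiv.swap_apply_left, Equiv.swap_apply_right,
          Fin.lt_def] at h2
        exact absurd h2 (Nat.lt_asymm (Nat.lt_succ_self i))
  · simp [sPerm, h]

theorem length_inv {n : ℕ} (w : Equiv.Perm (Fin n)) : length w⁻¹ = length w := by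
  refine Finset.card_bij' (fun p _ => (w⁻¹ p.2, w⁻¹ p.1)) (fun p _ => (w p.2, w p.1)) ?_ ?_ ?_ ?_
  all_goals rintro ⟨a, b⟩ hab
  all_goals simp [inversions] at hab ⊢
  all_goals tauto

theorem sPerm_inv (n i : ℕ) : (sPerm n i)⁻¹ = sPerm n i := by
  unfold sPerm; split_ifs <;> simp

theorem sPerm_comm (n : ℕ) {i j : ℕ} (h : i + 1 < j) :
    sPerm n i * sPerm n j = sPerm n j * sPerm n i := by
  unfold sPerm
  split_ifs
  · ext x
    simp only [Equiv.Perm.mul_apply, Equiv.swap_apply_def, Fin.ext_iff, apply_ite Fin.val]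
    split_ifs <;> omega
  all_goals simp

theorem sPerm_braid (n : ℕ) {i : ℕ} (h : i + 2 < n) :
    sPerm n i * sPerm n (i + 1) * sPerm n i
      = sPerm n (i + 1) * sPerm n i * sPerm n (i + 1) := by
  rw [sPerm_of_lt (by omega : i + 1 < n), sPerm_of_lt (by omega : i + 1 + 1 < n)]
  ext x
  simp only [Equiv.Perm.mul_apply, Equiv.swap_apply_def, Fin.ext_iff, apply_ite Fin.val]
  split_ifs <;> omega

/-- The braid relations for a family of operators. -/
structure Braid (T : ℕ → R → R) : Prop where
  comm : ∀ i j f, i + 1 < j → T i (T j f) = T j (T i f)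
  braid : ∀ i f, T i (T (i + 1) (T i f)) = T (i + 1) (T i (T (i + 1) f))

theorem opPerm_eq {n : ℕ} {T : ℕ → R → R} (hT : Braid T) (w : Equiv.Perm (Fin n)) (i : ℕ)
    (hi : length (sPerm n i * w) < length w) (f : R) :
    opPerm T w f = T i (opPerm T (sPerm n i * w) f) := by
  induction hm : length w using Nat.strong_induction_on generalizing w i with
  | _ m ih =>
  have ih' : ∀ (v : Equiv.Perm (Fin n)) (j : ℕ), length v < length w →
      length (sPerm n j * v) < length v →
      opPerm T v f = T j (opPerm T (sPerm n j * v) f) :=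
    fun v j hv hj => ih (length v) (hm ▸ hv) v j hj rfl
  have main : ∀ i j, i < j → length (sPerm n i * w) < length w →
      length (sPerm n j * w) < length w →
      T i (opPerm T (sPerm n i * w) f) = T j (opPerm T (sPerm n j * w) f) := by
    intro i j hij hi hj
    obtain ⟨ki, vi⟩ := (length_sPerm_mul_lt_iff w i).mp hi
    obtain ⟨kj, vj⟩ := (length_sPerm_mul_lt_iff w j).mp hj
    by_cases hc : i + 1 < j
    · have hji : length (sPerm n j * (sPerm n i * w)) < length (sPerm n i * w) := by
        rw [length_sPerm_mul_lt_iff]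
        refine ⟨kj, ?_⟩
        rw [mul_inv_rev, sPerm_inv, Equiv.Perm.mul_apply, Equiv.Perm.mul_apply, sPerm_of_lt ki,
          Equiv.swap_apply_of_ne_of_ne, Equiv.swap_apply_of_ne_of_ne]
        · exact vj
        all_goals simp only [ne_eq, Fin.ext_iff]; omega
      have hij' : length (sPerm n i * (sPerm n j * w)) < length (sPerm n j * w) := by
        rw [length_sPerm_mul_lt_iff]
        refine ⟨ki, ?_⟩
        rw [mul_inv_rev, sPerm_inv, Equiv.Perm.mul_apply, Equiv.Perm.mul_apply, sPerm_of_lt kj,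
          Equiv.swap_apply_of_ne_of_ne, Equiv.swap_apply_of_ne_of_ne]
        · exact vi
        all_goals simp only [ne_eq, Fin.ext_iff]; omega
      rw [ih' _ j hi hji, ih' _ i hj hij', hT.comm i j _ hc, ← mul_assoc, ← mul_assoc,
        sPerm_comm n hc]
    · obtain rfl : j = i + 1 := by omega
      have a1 : sPerm n i ⟨i, by omega⟩ = ⟨i + 1, ki⟩ := by
        rw [sPerm_of_lt ki, Equiv.swap_apply_left]
      have a2 : sPerm n i ⟨i + 1, ki⟩ = ⟨i, by omega⟩ := by
        rw [sPerm_of_lt ki, Equiv.swap_apply_right]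
      have a3 : sPerm n i ⟨i + 1 + 1, kj⟩ = ⟨i + 1 + 1, kj⟩ := by
        rw [sPerm_of_lt ki, Equiv.swap_apply_of_ne_of_ne] <;>
          (simp only [ne_eq, Fin.ext_iff]; omega)
      have b1 : sPerm n (i + 1) ⟨i, by omega⟩ = ⟨i, by omega⟩ := by
        rw [sPerm_of_lt kj, Equiv.swap_apply_of_ne_of_ne] <;>
          (simp only [ne_eq, Fin.ext_iff]; omega)
      have b2 : sPerm n (i + 1) ⟨i + 1, ki⟩ = ⟨i + 1 + 1, kj⟩ := by
        rw [sPerm_of_lt kj, Equiv.swap_apply_left]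
      have b3 : sPerm n (i + 1) ⟨i + 1 + 1, kj⟩ = ⟨i + 1, ki⟩ := by
        rw [sPerm_of_lt kj, Equiv.swap_apply_right]
      have c1 : length (sPerm n (i + 1) * (sPerm n i * w)) < length (sPerm n i * w) := by
        rw [length_sPerm_mul_lt_iff]
        refine ⟨kj, ?_⟩
        simp only [mul_inv_rev, sPerm_inv, Equiv.Perm.mul_apply, a2, a3]
        exact vj.trans vi
      have c2 : length (sPerm n i * (sPerm n (i + 1) * (sPerm n i * w)))
          < length (sPerm n (i + 1) * (sPerm n i * w)) := by
        rw [length_sPerm_mul_lt_iff]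
        refine ⟨ki, ?_⟩
        simp only [mul_inv_rev, sPerm_inv, Equiv.Perm.mul_apply, b1, b2, a1, a3]
        exact vj
      have d1 : length (sPerm n i * (sPerm n (i + 1) * w)) < length (sPerm n (i + 1) * w) := by
        rw [length_sPerm_mul_lt_iff]
        refine ⟨ki, ?_⟩
        simp only [mul_inv_rev, sPerm_inv, Equiv.Perm.mul_apply, b1, b2]
        exact vj.trans vi
      have d2 : length (sPerm n (i + 1) * (sPerm n i * (sPerm n (i + 1) * w)))
          < length (sPerm n i * (sPerm n (i + 1) * w)) := by
        rw [length_sPerm_mul_lt_iff]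
        refine ⟨kj, ?_⟩
        simp only [mul_inv_rev, sPerm_inv, Equiv.Perm.mul_apply, a2, a3, b1, b3]
        exact vi
      rw [ih' _ _ hi c1, ih' _ _ (c1.trans hi) c2, ih' _ _ hj d1, ih' _ _ (d1.trans hj) d2,
        hT.braid, ← mul_assoc, ← mul_assoc, sPerm_braid n kj, mul_assoc, mul_assoc]
  have hex : ∃ i, length (sPerm n i * w) < length w := ⟨i, hi⟩
  classical
  rw [opPerm, dif_pos hex]
  have hs := Nat.find_spec hex
  rcases lt_trichotomy i (Nat.find hex) with h | h | h
  · convert (main _ _ h hi hs).symm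
  · have : ∀ k, k = i → T k (opPerm T (sPerm n k * w) f) = T i (opPerm T (sPerm n i * w) f) := by
      rintro k rfl; rfl
    convert this _ h.symm
  · convert main _ _ h hs hi

/-! ### The braid relations hold -/

theorem braid_aux {A : Type*} [CommRing A] [IsDomain A] (s t : A →+* A) (G : A → A → A)
    (D E : A → A) (a b c k p q : A)
    (hG : ∀ x y, G x y = (1 + k * y) * (p + q * x))
    (hss : ∀ f, s (s f) = f) (htt : ∀ f, t (t f) = f) (hst : ∀ f, s (t (s f)) = t (s (t f)))
    (sa : s a = b) (sb : s b = a) (sc : s c = c) (ta : t a = a) (tb : t b = c) (tc : t c = b)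
    (sk : s k = k) (tk : t k = k) (sp : s p = p) (tp : t p = p) (sq : s q = q) (tq : t q = q)
    (hab : a - b ≠ 0) (hbc : b - c ≠ 0) (hac : a - c ≠ 0)
    (hD : ∀ f, (a - b) * D f = G a b * f - s (G a b * f))
    (hE : ∀ f, (b - c) * E f = G b c * f - t (G b c * f)) (f : A) :
    D (E (D f)) = E (D (E f)) := by
  simp only [hG, map_mul, map_add, map_one, sa, sb, tb, tc, sk, tk, sp, tp, sq, tq]
    at hD hE
  have e1 := hD f
  have e2 := congrArg s e1
  have e3 := congrArg t e1
  have e4 := congrArg s e3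
  have e5 := hE (D f)
  have e6 := congrArg s e5
  have e7 := hD (E (D f))
  have f1 := hE f
  have f2 := congrArg t f1
  have f3 := congrArg s f1
  have f4 := congrArg t f3
  have f5 := hD (E f)
  have f6 := congrArg t f5
  have f7 := hE (D (E f))
  simp only [map_mul, map_add, map_sub, map_one, sa, sb, sc, ta, tb, tc, sk, tk, sp, tp, sq, tq,
    hss, htt, hst] at e2 e3 e4 e6 f2 f3 f4 f6
  have h1 : ((a - b) * (b - c) * (a - c)) * D (E (D f)) =
      (1 + k * b) * (p + q * a) * (a - c) * ((1 + k * c) * (p + q * b) * D f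
        - (1 + k * b) * (p + q * c) * t (D f))
      - (1 + k * a) * (p + q * b) * (b - c) * ((1 + k * c) * (p + q * a) * s (D f)
        - (1 + k * a) * (p + q * c) * s (t (D f))) := by
    linear_combination (b - c) * (a - c) * e7 + (1 + k * b) * (p + q * a) * (a - c) * e5
      - (1 + k * a) * (p + q * b) * (b - c) * e6
  have h2 : ((a - b) * (b - c) * (a - c)) * E (D (E f)) =
      (1 + k * c) * (p + q * b) * (a - c) * ((1 + k * b) * (p + q * a) * E f
        - (1 + k * a) * (p + q * b) * s (E f))
      - (1 + k * b) * (p + q * c) * (a - b) * ((1 + k * c) * (p + q * a) * t (E f)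
        - (1 + k * a) * (p + q * c) * t (s (E f))) := by
    linear_combination (a - b) * (a - c) * f7 + (1 + k * c) * (p + q * b) * (a - c) * f5
      - (1 + k * b) * (p + q * c) * (a - b) * f6
  have hK : ((a - b) * (b - c) * (a - c)) ^ 2 ≠ 0 :=
    pow_ne_zero _ (mul_ne_zero (mul_ne_zero hab hbc) hac)
  apply mul_left_cancel₀ hK
  linear_combination ((a - b) * (b - c) * (a - c)) * (h1 - h2)
    + (1 + k * b) * (p + q * a) * (a - c) * ((1 + k * c) * (p + q * b) * ((b - c) * (a - c) * e1)
        - (1 + k * b) * (p + q * c) * ((a - b) * (b - c) * e3))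
      + (1 + k * a) * (p + q * b) * (b - c) * ((1 + k * c) * (p + q * a) * ((b - c) * (a - c) * e2)
        + (1 + k * a) * (p + q * c) * ((a - b) * (a - c) * e4))
    - ((1 + k * c) * (p + q * b) * (a - c) * ((1 + k * b) * (p + q * a) * ((a - b) * (a - c) * f1)
        - (1 + k * a) * (p + q * b) * ((a - b) * (b - c) * f3))
      + (1 + k * b) * (p + q * c) * (a - b) * ((1 + k * c) * (p + q * a) * ((a - b) * (a - c) * f2)
        + (1 + k * a) * (p + q * c) * ((b - c) * (a - c) * f4)))

theorem comm_aux {A : Type*} [CommRing A] [IsDomain A] (s t : A →+* A) (D E : A → A)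
    (a b c d g h : A) (hst : ∀ f, s (t f) = t (s f))
    (sc : s c = c) (sd : s d = d) (ta : t a = a) (tb : t b = b) (sh : s h = h) (tg : t g = g)
    (hab : a - b ≠ 0) (hcd : c - d ≠ 0)
    (hD : ∀ f, (a - b) * D f = g * f - s (g * f))
    (hE : ∀ f, (c - d) * E f = h * f - t (h * f)) (f : A) :
    D (E f) = E (D f) := by
  have e1 := hD f
  have e2 := congrArg t e1
  have e3 := hE (D f)
  have f1 := hE f
  have f2 := congrArg s f1
  have f3 := hD (E f)
  have tsg : t (s g) = s g := by rw [← hst, tg]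
  simp only [map_mul, map_sub, sc, sd, ta, tb, sh, tg, hst, tsg]
    at e1 e2 e3 f1 f2 f3
  apply mul_left_cancel₀ (mul_ne_zero hab hcd)
  linear_combination (c - d) * f3 + g * f1 - s g * f2 - (a - b) * e3 - h * e1 + t h * e2

theorem sAct_X (i k : ℕ) : sAct i (X k) = X (Equiv.swap i (i + 1) k) := rename_X _ _

theorem sAct_X_self (i : ℕ) : sAct i (X i) = X (i + 1) := by
  rw [sAct_X, Equiv.swap_apply_left]

theorem sAct_X_succ (i : ℕ) : sAct i (X (i + 1)) = X i := by
  rw [sAct_X, Equiv.swap_apply_right]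

theorem sAct_X_of_ne {i k : ℕ} (h1 : k ≠ i) (h2 : k ≠ i + 1) : sAct i (X k) = X k := by
  rw [sAct_X, Equiv.swap_apply_of_ne_of_ne h1 h2]

theorem sAct_C (i : ℕ) (r : Polynomial ℤ) : sAct i (C r) = C r := rename_C _ _

theorem sAct_sAct (i : ℕ) (f : R) : sAct i (sAct i f) = f := by
  have h : (sAct i).comp (sAct i) = AlgHom.id _ _ := by
    apply MvPolynomial.algHom_ext
    intro k
    simp [sAct_X]
  exact DFunLike.congr_fun h f

theorem sAct_comm {i j : ℕ} (hij : i + 1 < j) (f : R) :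
    sAct i (sAct j f) = sAct j (sAct i f) := by
  have h : (sAct i).comp (sAct j) = (sAct j).comp (sAct i) := by
    apply MvPolynomial.algHom_ext
    intro k
    simp only [AlgHom.comp_apply, sAct_X]
    congr 1
    simp only [Equiv.swap_apply_def]
    split_ifs <;> omega
  exact DFunLike.congr_fun h f

theorem sAct_braid (i : ℕ) (f : R) :
    sAct i (sAct (i + 1) (sAct i f)) = sAct (i + 1) (sAct i (sAct (i + 1) f)) := by
  have h : (sAct i).comp ((sAct (i + 1)).comp (sAct i))
      = (sAct (i + 1)).comp ((sAct i).comp (sAct (i + 1))) := by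
    apply MvPolynomial.algHom_ext
    intro k
    simp only [AlgHom.comp_apply, sAct_X]
    congr 1
    simp only [Equiv.swap_apply_def]
    split_ifs <;> omega
  exact DFunLike.congr_fun h f

theorem X_sub_X_ne_zero {i j : ℕ} (h : i ≠ j) : (X i - X j : R) ≠ 0 :=
  sub_ne_zero.mpr fun he => h (X_injective he)

/-- The operators `∂_i (1 + β x_{i+1}) (p + q x_i)` for constants `p`, `q` satisfy the braid
relations. -/
theorem braid_of (T : ℕ → R → R) (p q : Polynomial ℤ)
    (hT : ∀ i f, T i f = divDiff i ((1 + C β * X (i + 1)) * (C p + C q * X i) * f)) :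
    Braid T := by
  have hm : ∀ i f, (X i - X (i + 1)) * T i f
      = (1 + C β * X (i + 1)) * (C p + C q * X i) * f
        - sAct i ((1 + C β * X (i + 1)) * (C p + C q * X i) * f) := by
    intro i f
    rw [hT, mul_divDiff]
  constructor
  · intro i j f hij
    have i1 : ∀ k, j ≤ k → sAct i (X k) = X k := fun k hk =>
      sAct_X_of_ne (by omega) (by omega)
    have j1 : ∀ k, k ≤ i + 1 → sAct j (X k) = X k := fun k hk =>
      sAct_X_of_ne (by omega) (by omega)
    refine comm_aux (sAct i : R →+* R) (sAct j : R →+* R) (T i) (T j) (X i) (X (i + 1)) (X j)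
      (X (j + 1)) _ _ (sAct_comm hij) (i1 _ le_rfl) (i1 _ (Nat.le_succ j)) (j1 _ (Nat.le_succ i))
      (j1 _ le_rfl) ?_ ?_ (X_sub_X_ne_zero (by omega)) (X_sub_X_ne_zero (by omega))
      (hm i) (hm j) f
    · simp [i1 j le_rfl, i1 (j + 1) (Nat.le_succ j)]
    · simp [j1 i (Nat.le_succ i), j1 (i + 1) le_rfl]
  · intro i f
    exact braid_aux (sAct i : R →+* R) (sAct (i + 1) : R →+* R)
      (fun x y => (1 + C β * y) * (C p + C q * x)) (T i) (T (i + 1)) (X i) (X (i + 1))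
      (X (i + 1 + 1)) (C β) (C p) (C q) (fun _ _ => rfl) (sAct_sAct i) (sAct_sAct (i + 1))
      (sAct_braid i) (sAct_X_self i) (sAct_X_succ i) (sAct_X_of_ne (by omega) (by omega))
      (sAct_X_of_ne (by omega) (by omega)) (sAct_X_self (i + 1)) (sAct_X_succ (i + 1))
      (sAct_C _ _) (sAct_C _ _) (sAct_C _ _) (sAct_C _ _) (sAct_C _ _) (sAct_C _ _)
      (X_sub_X_ne_zero (by omega)) (X_sub_X_ne_zero (by omega)) (X_sub_X_ne_zero (by omega))
      (hm i) (hm (i + 1)) f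

theorem braid_divDiffB : Braid divDiffB :=
  braid_of _ 1 0 fun i f => by simp [divDiffB]

theorem braid_piB : Braid piB :=
  braid_of _ 0 1 fun i f => by simp [piB, divDiffB, mul_assoc]

theorem groth_longElt (n : ℕ) : groth (longElt n) = xRho n := by
  have h : ¬ ∃ i, length (sPerm n i * 1) < length (1 : Equiv.Perm (Fin n)) := by
    rintro ⟨i, hi⟩
    obtain ⟨h, h'⟩ := (length_sPerm_mul_lt_iff _ _).mp hi
    exact absurd h' (Nat.lt_asymm (Nat.lt_succ_self i))
  rw [groth, inv_mul_cancel, opPerm, dif_neg h]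

theorem groth_eq {n : ℕ} (w : Equiv.Perm (Fin n)) (i : ℕ)
    (hi : length w < length (w * sPerm n i)) :
    groth w = divDiffB i (groth (w * sPerm n i)) := by
  unfold groth
  rw [mul_inv_rev, sPerm_inv, mul_assoc]
  apply opPerm_eq braid_divDiffB
  have h2 : length (sPerm n i * (sPerm n i * w⁻¹)) < length (sPerm n i * w⁻¹) := by
    have e : sPerm n i * (sPerm n i * w⁻¹) = w⁻¹ := by
      rw [← mul_assoc]
      nth_rewrite 1 [← sPerm_inv]
      rw [inv_mul_cancel, one_mul]
    rw [e, length_inv, ← length_inv (sPerm n i * w⁻¹), mul_inv_rev, inv_inv, sPerm_inv]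
    exact hi
  rw [length_sPerm_mul_lt_iff] at h2 ⊢
  obtain ⟨h, h2⟩ := h2
  refine ⟨h, ?_⟩
  rw [mul_inv_rev, inv_inv, sPerm_inv, sPerm_of_lt h, Equiv.Perm.mul_apply,
    Equiv.Perm.mul_apply, Equiv.swap_apply_left, Equiv.swap_apply_right] at h2
  rw [mul_inv_rev, inv_inv, Equiv.Perm.mul_apply, Equiv.Perm.mul_apply]
  exact Fin.rev_lt_rev.mpr h2

/-! ### The `β`-Grothendieck symmetric function -/

/-- The permutation `1^N × w`: it fixes the first `N` points and permutes the last `n` points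
in the way of `w`. -/
def shiftPerm (N : ℕ) {n : ℕ} (w : Equiv.Perm (Fin n)) : Equiv.Perm (Fin (N + n)) :=
  finSumFinEquiv.permCongr (Equiv.sumCongr (Equiv.refl (Fin N)) w)

open Classical in
/-- The `β`-Grothendieck symmetric function `G_w = lim_{N → ∞} 𝔊_{1^N × w}`, a formal power series
in infinitely many variables. Its coefficient at a monomial is the eventual value of the
coefficients of `𝔊_{1^N × w}` (with the value `0` where there is none). -/
noncomputable def stableGroth {n : ℕ} (w : Equiv.Perm (Fin n)) :
    MvPowerSeries ℕ (Polynomial ℤ) := fun d =>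
  if h : ∃ c, ∀ᶠ N in Filter.atTop, coeff d (groth (shiftPerm N w)) = c then h.choose else 0

open Classical in
/-- `F(x_1, …, x_n)`: the power series `F` with all variables after the first `n` set to `0`. -/
noncomputable def restrictVars (n : ℕ) (F : MvPowerSeries ℕ (Polynomial ℤ)) :
    MvPowerSeries ℕ (Polynomial ℤ) := fun d =>
  if ∀ k ∈ d.support, k < n then MvPowerSeries.coeff d F else 0

end Groth

namespace Groth

open MvPolynomial

/-! ### The operators `π_i` -/

/-! Indices start at `0`. Prepending one fixed point is an operator: for `u ∈ S_k`, `𝔊_{1×u} = π_0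
π_1 ⋯ π_{k-1} 𝔊_u` (`groth_one_times`). For `u` the long element this is a computation from `x^ρ`.
It descends the weak order because `∂_{i+1} π_i π_{i+1} = π_i π_{i+1} ∂_i`, so `∂_i` passes through
the product with its index raised by one.

Iterating gives `𝔊_{1^N×w}` as a product of ever longer runs `π_0 ⋯ π_{N+n-1}`. With all but the
first `m` variables set to `0`, every `π_i` with `i + 1 ≥ m` becomes the identity
(`truncVars_piB_of_le`), so each long run shrinks to `c = π_0 ⋯ π_{m-2}`.

Finally `c^N = π_{w_0}` in `S_m` once `N ≥ m - 1` (`iterate_run_piB`), by idempotence and the same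
index shift. Hence the truncations stabilise for each `m`, which gives the limit. For `m = n` one
may start from `𝔊_w` itself, which involves only the first `n` variables; this gives the formula. -/

theorem mul_divDiffB (i : ℕ) (f : R) :
    (X i - X (i + 1)) * divDiffB i f
      = (1 + C β * X (i + 1)) * f - (1 + C β * X i) * sAct i f := by
  rw [divDiffB, mul_divDiff, map_mul, map_add, map_mul, map_one, sAct_C, sAct_X_succ]

theorem mul_piB (i : ℕ) (f : R) :
    (X i - X (i + 1)) * piB i f
      = (1 + C β * X (i + 1)) * X i * f - (1 + C β * X i) * X (i + 1) * sAct i f := by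
  rw [piB, mul_divDiffB, map_mul, sAct_X_self]
  ring

theorem divDiffB_mul_of_sAct_eq {i : ℕ} {g : R} (hg : sAct i g = g) (f : R) :
    divDiffB i (g * f) = g * divDiffB i f := by
  apply mul_left_cancel₀ (X_sub_X_ne_zero (Nat.succ_ne_self i).symm)
  have h := mul_divDiffB i f
  rw [mul_divDiffB, map_mul, hg]
  linear_combination -g * h

theorem piB_of_sAct_eq {i : ℕ} {f : R} (hf : sAct i f = f) : piB i f = f := by
  apply mul_left_cancel₀ (X_sub_X_ne_zero (Nat.succ_ne_self i).symm)
  rw [mul_piB, hf]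
  ring

/-- In `mul_piB` both `x_i - x_{i+1}` and the right side change sign under `s_i`. -/
theorem sAct_piB (i : ℕ) (f : R) : sAct i (piB i f) = piB i f := by
  apply mul_left_cancel₀ (X_sub_X_ne_zero (Nat.succ_ne_self i).symm)
  have h := congrArg (sAct i) (mul_piB i f)
  simp only [map_mul, map_add, map_sub, map_one, sAct_C, sAct_X_self, sAct_X_succ, sAct_sAct] at h
  have h' := mul_piB i f
  linear_combination -h - h'

theorem piB_piB (i : ℕ) (f : R) : piB i (piB i f) = piB i f :=
  piB_of_sAct_eq (sAct_piB i f)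

theorem sAct_X_mul_X_succ (i : ℕ) : sAct i (X i * X (i + 1)) = X i * X (i + 1) := by
  rw [map_mul, sAct_X_self, sAct_X_succ, mul_comm]

/-- `x_i` is fixed by `s_{i+1}`, so it moves inside `∂_{i+1}`. The resulting factor `x_i x_{i+1}` is
symmetric under `s_i`, so `∂_i` passes it and the braid relation of the `∂`'s becomes an
intertwining relation. -/
theorem piB_piB_succ (i : ℕ) (f : R) :
    piB i (piB (i + 1) f) = divDiffB i (divDiffB (i + 1) (X i * X (i + 1) * f)) := by
  rw [piB, piB, mul_assoc, ← divDiffB_mul_of_sAct_eq]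
  exact sAct_X_of_ne (by omega) (by omega)

/-- Operators which `π_i π_{i+1}` intertwines as the braid relations suggest. -/
structure Intertwined (T : ℕ → R → R) : Prop where
  comm : ∀ i j f, i + 1 < j ∨ j + 1 < i → T i (piB j f) = piB j (T i f)
  braid : ∀ i f, T (i + 1) (piB i (piB (i + 1) f)) = piB i (piB (i + 1) (T i f))

theorem intertwined_piB : Intertwined piB where
  comm i j f h := h.elim (braid_piB.comm i j f) fun h => (braid_piB.comm j i f h).symm
  braid i f := (braid_piB.braid i f).symm

theorem intertwined_divDiffB : Intertwined divDiffB where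
  comm i j f h := by
    have hX : sAct i (X j) = X j := sAct_X_of_ne (by omega) (by omega)
    rw [piB, piB, ← divDiffB_mul_of_sAct_eq hX]
    rcases h with h | h
    · exact braid_divDiffB.comm i j _ h
    · exact (braid_divDiffB.comm j i _ h).symm
  braid i f := by
    rw [piB_piB_succ, piB_piB_succ, ← divDiffB_mul_of_sAct_eq (sAct_X_mul_X_succ i),
      braid_divDiffB.braid]

/-! ### Products of consecutive operators -/

/-- The product `T_0 T_1 ⋯ T_{k-1}`. -/
def run (T : ℕ → R → R) : ℕ → R → R
  | 0, f => f
  | k + 1, f => run T k (T k f)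

theorem Intertwined.run_comm {T : ℕ → R → R} (hT : Intertwined T) {i k : ℕ} (h : k < i) (f : R) :
    T i (run piB k f) = run piB k (T i f) := by
  induction k generalizing f with
  | zero => rfl
  | succ k ih => rw [run, run, ih (by omega), hT.comm _ _ _ (Or.inr h)]

/-- `T_i` commutes with the factors `π_j`, `j > i + 1`, becomes `T_{i+1}` on crossing `π_i π_{i+1}`,
and then commutes with the remaining `π_j`, `j < i`. -/
theorem Intertwined.run_shift {T : ℕ → R → R} (hT : Intertwined T) {i k : ℕ} (h : i + 1 < k)
    (f : R) : T (i + 1) (run piB k f) = run piB k (T i f) := by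
  induction k generalizing f with
  | zero => omega
  | succ k ih =>
    rcases (Nat.lt_succ_iff.mp h).lt_or_eq with h' | rfl
    · rw [run, run, ih h', hT.comm _ _ _ (Or.inl h')]
    · rw [run, run, run, run, hT.run_comm (Nat.lt_succ_self i), hT.braid]

/-- At each stage the variables before the last one are fixed by the innermost `s_j` and leave
`∂_j`; the `x_j` left behind turns `∂_j` into `π_j`. -/
theorem run_divDiffB_prod_mul (k : ℕ) (f : R) :
    run divDiffB k ((∏ i ∈ Finset.range k, X i) * f) = run piB k f := by
  induction k generalizing f with
  | zero => simp [run]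
  | succ k ih =>
    rw [run, run, ← ih, Finset.prod_range_succ, mul_assoc, divDiffB_mul_of_sAct_eq, piB]
    rw [map_prod]
    refine Finset.prod_congr rfl fun i hi => ?_
    have := Finset.mem_range.mp hi
    exact sAct_X_of_ne (by omega) (by omega)

/-- Each run that `π_i` crosses raises its index by one. When the index reaches `k - 1`, the next
run ends in `π_{k-1}` and absorbs it by idempotence; this takes `k - i` runs in all. -/
theorem run_piB_absorb {i k N : ℕ} (hi : i < k) (hN : k ≤ i + N) (f : R) :
    (run piB k)^[N] (piB i f) = (run piB k)^[N] f := by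
  induction N generalizing i f with
  | zero => omega
  | succ N ih =>
    rw [Function.iterate_succ_apply, Function.iterate_succ_apply]
    by_cases h : i + 1 < k
    · rw [← intertwined_piB.run_shift h, ih h (by omega)]
    · obtain rfl : k = i + 1 := by omega
      rw [run, run, piB_piB]

/-! ### The operator of the long element -/

theorem longElt_inv (n : ℕ) : (longElt n)⁻¹ = longElt n := by
  rw [inv_eq_iff_mul_eq_one]
  ext x
  simp [longElt]

/-- Every `s_i` is a left descent of the long element, so `π_{w_0}` can be written with `π_i` in
front. -/
theorem piB_opPerm_longElt {n i : ℕ} (h : i + 1 < n) (f : R) :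
    piB i (opPerm piB (longElt n) f) = opPerm piB (longElt n) f := by
  have hl : length (sPerm n i * longElt n) < length (longElt n) := by
    rw [length_sPerm_mul_lt_iff]
    refine ⟨h, ?_⟩
    rw [longElt_inv]
    simp only [longElt, Fin.revPerm_apply, Fin.lt_def, Fin.val_rev]
    omega
  rw [opPerm_eq braid_piB _ i hl, piB_piB]

theorem run_of_forall_eq {T : ℕ → R → R} {k : ℕ} {f : R} (h : ∀ i < k, T i f = f) :
    run T k f = f := by
  induction k with
  | zero => rfl
  | succ k ih => rw [run, h k (Nat.lt_succ_self k), ih fun i hi => h i (Nat.lt_succ_of_lt hi)]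

theorem apply_opPerm_of_absorb {n : ℕ} {T : ℕ → R → R} {α : Type*} (Q : R → α)
    (hQ : ∀ i f, i + 1 < n → Q (T i f) = Q f) (w : Equiv.Perm (Fin n)) (f : R) :
    Q (opPerm T w f) = Q f := by
  classical
  induction hm : length w using Nat.strong_induction_on generalizing w with
  | _ m ih =>
  rw [opPerm]
  split_ifs with h
  · have hs := Nat.find_spec h
    rw [hQ _ _ ((length_sPerm_mul_lt_iff _ _).mp hs).1]
    exact ih _ (hm ▸ hs) _ rfl
  · rfl

/-- Evaluate `c^N π_{w_0}`, with `c` the run, in two ways: `c^N` absorbs every factor of `π_{w_0}`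
on its right, while `π_{w_0}` absorbs every factor of `c` on its left. -/
theorem iterate_run_piB {n N : ℕ} (hN : n ≤ N + 1) (f : R) :
    (run piB (n - 1))^[N] f = opPerm piB (longElt n) f := by
  have h1 : (run piB (n - 1))^[N] (opPerm piB (longElt n) f) = (run piB (n - 1))^[N] f :=
    apply_opPerm_of_absorb _ (fun i f hi => run_piB_absorb (by omega) (by omega) f) _ f
  have h2 : run piB (n - 1) (opPerm piB (longElt n) f) = opPerm piB (longElt n) f :=
    run_of_forall_eq fun i hi => piB_opPerm_longElt (by omega) f
  rw [← h1, Function.iterate_fixed h2]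

/-! ### Setting variables to zero -/

/-- Set all variables after the first `m` to `0`. -/
noncomputable def truncVars (m : ℕ) : R →ₐ[Polynomial ℤ] R :=
  aeval fun i => if i < m then X i else 0

theorem truncVars_X (m i : ℕ) : truncVars m (X i) = if i < m then X i else 0 := aeval_X _ _

theorem truncVars_C (m : ℕ) (r : Polynomial ℤ) : truncVars m (C r) = C r := aeval_C _ _

theorem truncVars_sAct {m i : ℕ} (h : i + 1 < m) (f : R) :
    truncVars m (sAct i f) = sAct i (truncVars m f) := by
  have h : (truncVars m).comp (sAct i) = (sAct i).comp (truncVars m) := by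
    apply MvPolynomial.algHom_ext
    intro k
    simp only [AlgHom.comp_apply, sAct_X, truncVars_X, apply_ite (sAct i), map_zero]
    have : Equiv.swap i (i + 1) k < m ↔ k < m := by
      rw [Equiv.swap_apply_def]; split_ifs <;> omega
    simp only [this]
  exact DFunLike.congr_fun h f

theorem truncVars_divDiffB {m i : ℕ} (h : i + 1 < m) (f : R) :
    truncVars m (divDiffB i f) = divDiffB i (truncVars m f) := by
  apply mul_left_cancel₀ (X_sub_X_ne_zero (Nat.succ_ne_self i).symm)
  have := congrArg (truncVars m) (mul_divDiffB i f)
  simp only [map_mul, map_add, map_sub, map_one, truncVars_C, truncVars_X, h,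
    (by omega : i < m), if_true, truncVars_sAct h] at this
  rw [mul_divDiffB, this]

theorem truncVars_piB {m i : ℕ} (h : i + 1 < m) (f : R) :
    truncVars m (piB i f) = piB i (truncVars m f) := by
  rw [piB, piB, truncVars_divDiffB h, map_mul, truncVars_X, if_pos (by omega)]

theorem truncVars_piB_of_le {m i : ℕ} (h : m ≤ i + 1) (f : R) :
    truncVars m (piB i f) = truncVars m f := by
  -- Killing `x_{i+1}` alone suffices: `mul_piB` then reads `x_i · e (π_i f) = x_i · e f`, and `x_i`
  -- cancels even if `truncVars m` would kill it too.
  let e : R →ₐ[Polynomial ℤ] R := aeval fun j => if j = i + 1 then 0 else X j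
  have he : (truncVars m).comp e = truncVars m := by
    apply MvPolynomial.algHom_ext
    intro k
    simp only [AlgHom.comp_apply, e, aeval_X]
    split_ifs with hk
    · rw [map_zero, truncVars_X, if_neg (by omega)]
    · rfl
  have h2 : e (piB i f) = e f := by
    have := congrArg e (mul_piB i f)
    have hC : e (C β) = C β := aeval_C _ _
    have h0 : e (X (i + 1)) = 0 := by simp [e]
    have h1 : e (X i) = X i := by simp [e]
    simp only [map_mul, map_add, map_sub, map_one, hC, h0, h1] at this
    apply mul_left_cancel₀ (X_ne_zero i)
    linear_combination this
  rw [← he, AlgHom.comp_apply, h2, AlgHom.comp_apply]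

theorem truncVars_run_piB (m k : ℕ) (f : R) :
    truncVars m (run piB k f) = run piB (min k (m - 1)) (truncVars m f) := by
  induction k generalizing f with
  | zero => simp [run]
  | succ k ih =>
    rw [run, ih]
    by_cases h : k + 1 < m
    · rw [truncVars_piB h, min_eq_left (by omega), min_eq_left (by omega), run]
    · rw [truncVars_piB_of_le (by omega), min_eq_right (by omega), min_eq_right (by omega)]

open Classical in
theorem coeff_truncVars (m : ℕ) (f : R) (d : ℕ →₀ ℕ) :
    coeff d (truncVars m f) = if ∀ k ∈ d.support, k < m then coeff d f else 0 := by
  induction f using MvPolynomial.induction_on' with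
  | add p q hp hq => rw [map_add, coeff_add, hp, hq, coeff_add]; split_ifs <;> simp
  | monomial u a =>
    by_cases hu : ∀ k ∈ u.support, k < m
    · have : truncVars m (monomial u a) = monomial u a := by
        rw [truncVars, aeval_monomial, monomial_eq (s := u)]
        congr 1
        refine Finset.prod_congr rfl fun k hk => ?_
        exact congrArg (· ^ u k) (if_pos (hu k hk))
      rw [this, coeff_monomial]
      split_ifs with h1 h2 <;> first | rfl | (subst h1; exact absurd hu h2)
    · have : truncVars m (monomial u a) = 0 := by
        push Not at hu
        obtain ⟨k, hk, hkm⟩ := hu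
        rw [truncVars, aeval_monomial, Finsupp.prod, Finset.prod_eq_zero hk, mul_zero]
        rw [if_neg (by omega), zero_pow (Finsupp.mem_support_iff.mp hk)]
      rw [this, coeff_monomial, coeff_zero]
      split_ifs with h1 h2 <;> first | rfl | (subst h2; exact absurd h1 hu)

/-! ### Grothendieck polynomials -/

theorem length_lt_mul_sPerm_iff {n : ℕ} (w : Equiv.Perm (Fin n)) (i : ℕ) :
    length w < length (w * sPerm n i) ↔
      ∃ h : i + 1 < n, w ⟨i, Nat.lt_of_succ_lt h⟩ < w ⟨i + 1, h⟩ := by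
  have e : sPerm n i * (w * sPerm n i)⁻¹ = w⁻¹ := by
    rw [mul_inv_rev, mul_inv_cancel_left]
  rw [← length_inv w, ← e, ← length_inv (w * sPerm n i), length_sPerm_mul_lt_iff, inv_inv]
  refine exists_congr fun h => ?_
  rw [sPerm_of_lt h, Equiv.Perm.mul_apply, Equiv.Perm.mul_apply, Equiv.swap_apply_left,
    Equiv.swap_apply_right]

/-- Induction from the long element downwards in the weak order. -/
theorem weakOrder_induction {n : ℕ} {P : Equiv.Perm (Fin n) → Prop} (base : P (longElt n))
    (step : ∀ w i, length w < length (w * sPerm n i) → P (w * sPerm n i) → P w)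
    (w : Equiv.Perm (Fin n)) : P w := by
  have hbd : ∀ v : Equiv.Perm (Fin n), length v ≤ n * n := fun v =>
    (Finset.card_le_univ _).trans (by simp)
  induction hm : n * n - length w using Nat.strong_induction_on generalizing w with
  | _ m ih =>
  by_cases h : ∃ i, length w < length (w * sPerm n i)
  · obtain ⟨i, hi⟩ := h
    have := hbd (w * sPerm n i)
    exact step w i hi (ih _ (by omega) _ rfl)
  · convert base
    push Not at h
    -- Without ascents `w` is strictly decreasing, so `w w_0` is an increasing permutation, hence
    -- the identity.
    have hanti : StrictAnti w := by
      cases n with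
      | zero => exact fun a => a.elim0
      | succ n =>
        rw [Fin.strictAnti_iff_succ_lt]
        intro i
        have h1 := (length_lt_mul_sPerm_iff w i).not.mp (not_lt.mpr (h i))
        push Not at h1
        refine lt_of_le_of_ne (h1 (by omega)) fun he => ?_
        have := w.injective he
        simp [Fin.ext_iff] at this
    have : StrictMono (w * longElt n) := fun a b hab =>
      hanti (Fin.rev_lt_rev.mpr hab)
    have hid : w * longElt n = 1 :=
      Equiv.ext fun x => le_antisymm (this.le_id x) (this.id_le x)
    rw [eq_inv_of_mul_eq_one_left hid, longElt_inv]

theorem truncVars_groth {n : ℕ} (w : Equiv.Perm (Fin n)) : truncVars n (groth w) = groth w := by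
  induction w using weakOrder_induction with
  | base =>
    rw [groth_longElt, xRho, map_prod]
    refine Finset.prod_congr rfl fun i hi => ?_
    rw [map_pow, truncVars_X, if_pos (Finset.mem_range.mp hi)]
  | step w i hi ih =>
    rw [groth_eq w i hi, truncVars_divDiffB ((length_lt_mul_sPerm_iff w i).mp hi).1, ih]

theorem xRho_succ (k : ℕ) : xRho (k + 1) = (∏ i ∈ Finset.range k, X i) * xRho k := by
  rw [xRho, xRho, Finset.prod_range_succ, ← Finset.prod_mul_distrib]
  simp only [Nat.add_sub_cancel, Nat.sub_self, pow_zero, mul_one]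
  refine Finset.prod_congr rfl fun i hi => ?_
  have := Finset.mem_range.mp hi
  rw [← pow_succ']
  congr 1
  omega

/-! ### Prepending a fixed point -/

/-- Here `u` is the long element with the value `0` moved from the last position to position `j`.
Position `j` is an ascent, and `u s_j` is the same permutation for `j + 1`. At `j = 0` this computes
`𝔊` of `1 × w_0`. -/
theorem run_divDiffB_groth {k j : ℕ} (hj : j ≤ k) (u : Equiv.Perm (Fin (k + 1)))
    (h1 : ∀ i : Fin (k + 1), (i : ℕ) < j → (u i : ℕ) = k - i)
    (h2 : ∀ i : Fin (k + 1), (i : ℕ) = j → (u i : ℕ) = 0)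
    (h3 : ∀ i : Fin (k + 1), j < (i : ℕ) → (u i : ℕ) = k + 1 - i) :
    run divDiffB j (groth u) = run divDiffB k (xRho (k + 1)) := by
  induction hj using Nat.decreasingInduction generalizing u with
  | self =>
    have : u = longElt (k + 1) := by
      ext i
      rw [longElt, Fin.revPerm_apply, Fin.val_rev]
      rcases lt_or_eq_of_le (Nat.lt_succ_iff.mp i.2) with h | h
      · rw [h1 i h]; omega
      · rw [h2 i h]; omega
    rw [this, groth_longElt]
  | of_succ j hj ih =>
    have hl : length u < length (u * sPerm (k + 1) j) := by
      rw [length_lt_mul_sPerm_iff]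
      refine ⟨by omega, ?_⟩
      rw [Fin.lt_def, h2 _ rfl, h3 _ (Nat.lt_succ_self j)]
      simp only
      omega
    have hs : ∀ i : Fin (k + 1), (sPerm (k + 1) j i : ℕ)
        = if (i : ℕ) = j then j + 1 else if (i : ℕ) = j + 1 then j else i := by
      intro i
      rw [sPerm_of_lt (by omega), Equiv.swap_apply_def]
      simp only [Fin.ext_iff, apply_ite Fin.val]
    rw [groth_eq u j hl, ← ih (u * sPerm (k + 1) j), run]
    all_goals
      intro i hi
      have hsi := hs i
      rw [Equiv.Perm.mul_apply]
    · by_cases hij : (i : ℕ) = j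
      · rw [if_pos hij] at hsi
        rw [h3 _ (by omega)]
        omega
      · rw [if_neg hij, if_neg (by omega)] at hsi
        rw [h1 _ (by omega), hsi]
    · rw [if_neg (by omega), if_pos hi] at hsi
      exact h2 _ hsi
    · rw [if_neg (by omega), if_neg (by omega)] at hsi
      rw [h3 _ (by omega), hsi]

/-- `v` is `1 × u`; the separate `k'` allows sizes that are only propositionally equal to `k + 1`.
An ascent of `u` at `i` is one of `v` at `i + 1`, and `run_shift` turns `∂_{i+1}` outside the run
into `∂_i` inside. -/
theorem groth_one_times {k k' : ℕ} (hk : k' = k + 1) (u : Equiv.Perm (Fin k))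
    (v : Equiv.Perm (Fin k'))
    (hv : ∀ (i : ℕ) (hi : i < k), (v ⟨i + 1, by omega⟩ : ℕ) = u ⟨i, hi⟩ + 1) :
    groth v = run piB k (groth u) := by
  subst hk
  induction u using weakOrder_induction generalizing v with
  | base =>
    -- All values at positive positions are positive by `hv`, so `0` can only be taken at `0`.
    have h0 : (v ⟨0, Nat.succ_pos k⟩ : ℕ) = 0 := by
      have h : v (v⁻¹ ⟨0, Nat.succ_pos k⟩) = ⟨0, Nat.succ_pos k⟩ := v.apply_symm_apply _
      rcases hx : v⁻¹ ⟨0, Nat.succ_pos k⟩ with ⟨_ | i, hi⟩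
      · rw [hx] at h
        rw [h]
      · rw [hx] at h
        have := hv i (by omega)
        rw [h] at this
        simp at this
    have h := run_divDiffB_groth (Nat.zero_le k) v (fun i hi => absurd hi (Nat.not_lt_zero _))
      (fun i hi => by rw [← h0]; congr 2; exact Fin.ext hi) fun i hi => by
        obtain ⟨_ | i, hik⟩ := i
        · exact absurd hi (lt_irrefl _)
        · rw [hv i (by omega)]
          simp only [longElt, Fin.revPerm_apply, Fin.val_rev]
          omega
    rwa [run, xRho_succ, run_divDiffB_prod_mul, ← groth_longElt k] at h
  | step u i hi ih =>
    obtain ⟨hik, hlt⟩ := (length_lt_mul_sPerm_iff u i).mp hi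
    have hl : length v < length (v * sPerm (k + 1) (i + 1)) := by
      rw [length_lt_mul_sPerm_iff]
      refine ⟨by omega, ?_⟩
      rw [Fin.lt_def, hv i (by omega), hv (i + 1) hik]
      exact Nat.succ_lt_succ hlt
    rw [groth_eq u i hi, groth_eq v (i + 1) hl, ih (v * sPerm (k + 1) (i + 1)),
      intertwined_divDiffB.run_shift hik]
    intro j hj
    have e : sPerm (k + 1) (i + 1) ⟨j + 1, by omega⟩
        = ⟨(sPerm k i ⟨j, hj⟩ : ℕ) + 1, by omega⟩ := by
      simp only [sPerm_of_lt hik, sPerm_of_lt (Nat.succ_lt_succ hik), Equiv.swap_apply_def, Fin.ext_iff, apply_ite Fin.val]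
      split_ifs <;> omega
    rw [Equiv.Perm.mul_apply, Equiv.Perm.mul_apply, e, hv _ (Fin.is_lt _)]

theorem groth_congr {k k' : ℕ} (hk : k' = k) (u : Equiv.Perm (Fin k)) (v : Equiv.Perm (Fin k'))
    (hv : ∀ (i : ℕ) (hi : i < k), (v ⟨i, by omega⟩ : ℕ) = u ⟨i, hi⟩) : groth v = groth u := by
  subst hk
  congr 1
  ext i
  exact hv i i.2

/-! ### Iterated shifts and the stable limit -/

theorem shiftPerm_apply_of_lt (N : ℕ) {n : ℕ} (w : Equiv.Perm (Fin n)) {i : ℕ} (hi : i < N) :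
    (shiftPerm N w ⟨i, by omega⟩ : ℕ) = i := by
  have : (⟨i, by omega⟩ : Fin (N + n)) = finSumFinEquiv (Sum.inl ⟨i, hi⟩) := by
    simp
  rw [shiftPerm, this, Equiv.permCongr_apply, Equiv.symm_apply_apply]
  simp

theorem shiftPerm_apply_add (N : ℕ) {n : ℕ} (w : Equiv.Perm (Fin n)) {i : ℕ} (hi : i < n) :
    (shiftPerm N w ⟨N + i, by omega⟩ : ℕ) = N + w ⟨i, hi⟩ := by
  have : (⟨N + i, by omega⟩ : Fin (N + n)) = finSumFinEquiv (Sum.inr ⟨i, hi⟩) := by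
    simp
  rw [shiftPerm, this, Equiv.permCongr_apply, Equiv.symm_apply_apply]
  simp

theorem groth_shiftPerm_zero {n : ℕ} (w : Equiv.Perm (Fin n)) :
    groth (shiftPerm 0 w) = groth w := by
  refine groth_congr (Nat.zero_add n) w _ fun i hi => ?_
  have := shiftPerm_apply_add 0 w hi
  simpa using this

theorem groth_shiftPerm_succ (N : ℕ) {n : ℕ} (w : Equiv.Perm (Fin n)) :
    groth (shiftPerm (N + 1) w) = run piB (N + n) (groth (shiftPerm N w)) := by
  refine groth_one_times (by omega) (shiftPerm N w) _ fun i hi => ?_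
  by_cases h : i < N
  · rw [shiftPerm_apply_of_lt _ _ (by omega : i + 1 < N + 1), shiftPerm_apply_of_lt _ _ h]
  · obtain ⟨j, rfl⟩ := Nat.exists_eq_add_of_le (not_lt.mp h)
    have h1 := shiftPerm_apply_add (N + 1) w (i := j) (by omega)
    rw [shiftPerm_apply_add N w (by omega)]
    simp only [Nat.add_right_comm N j 1] at h1 ⊢
    omega

/-- The bound `h` makes every run from `N₀` on at least `m - 1` long, so truncation cuts each to
exactly that length. -/
theorem truncVars_groth_shiftPerm {m n N₀ : ℕ} (h : m ≤ N₀ + n + 1) (w : Equiv.Perm (Fin n))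
    (j : ℕ) :
    truncVars m (groth (shiftPerm (N₀ + j) w))
      = (run piB (m - 1))^[j] (truncVars m (groth (shiftPerm N₀ w))) := by
  induction j with
  | zero => rfl
  | succ j ih =>
    rw [← add_assoc, groth_shiftPerm_succ, truncVars_run_piB, min_eq_right (by omega), ih,
      Function.iterate_succ_apply']

theorem eventually_truncVars_groth (m : ℕ) {n : ℕ} (w : Equiv.Perm (Fin n)) :
    ∃ F : R, ∀ᶠ N in Filter.atTop, truncVars m (groth (shiftPerm N w)) = F := by
  -- Starting at shift `m` makes the runs long enough even if `n < m`; `m` further shifts are enough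
  -- to produce `π_{w_0}`.
  refine ⟨opPerm piB (longElt m) (truncVars m (groth (shiftPerm m w))), ?_⟩
  filter_upwards [Filter.eventually_ge_atTop (m + m)] with N hN
  obtain ⟨j, rfl⟩ := Nat.exists_eq_add_of_le (le_of_add_le_left hN)
  rw [truncVars_groth_shiftPerm (by omega), iterate_run_piB (by omega)]

theorem truncVars_groth_eq_opPerm {n N : ℕ} (hN : n ≤ N + 1) (w : Equiv.Perm (Fin n)) :
    truncVars n (groth (shiftPerm N w)) = opPerm piB (longElt n) (groth w) := by
  have h := truncVars_groth_shiftPerm (m := n) (N₀ := 0) (by omega) w N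
  rwa [zero_add, groth_shiftPerm_zero, truncVars_groth, iterate_run_piB hN] at h

theorem eventually_coeff_groth {n : ℕ} (w : Equiv.Perm (Fin n)) (d : ℕ →₀ ℕ) :
    ∀ᶠ N in Filter.atTop,
      coeff d (groth (shiftPerm N w)) = MvPowerSeries.coeff d (stableGroth w) := by
  classical
  obtain ⟨m, hm⟩ : ∃ m, ∀ k ∈ d.support, k < m :=
    ⟨d.support.sup id + 1, fun k hk => Nat.lt_succ_of_le (Finset.le_sup (f := id) hk)⟩
  obtain ⟨F, hF⟩ := eventually_truncVars_groth m w
  have h : ∃ c, ∀ᶠ N in Filter.atTop, coeff d (groth (shiftPerm N w)) = c := by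
    refine ⟨coeff d F, hF.mono fun N hN => ?_⟩
    rw [← hN, coeff_truncVars, if_pos hm]
  have e : MvPowerSeries.coeff d (stableGroth w) = h.choose := by
    change stableGroth w d = _
    rw [stableGroth, dif_pos h]
  rw [e]
  exact h.choose_spec

theorem coe_opPerm_groth {n : ℕ} (w : Equiv.Perm (Fin n)) :
    ((opPerm piB (longElt n) (groth w) : R) : MvPowerSeries ℕ (Polynomial ℤ))
      = restrictVars n (stableGroth w) := by
  classical
  ext1 d
  -- One `N` serves both purposes: the truncation to `n` variables is already `π_{w_0} 𝔊_w`, and the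
  -- coefficient at `d` has reached its limit.
  obtain ⟨N, hN, hc⟩ := ((Filter.eventually_ge_atTop n).and (eventually_coeff_groth w d)).exists
  rw [coeff_coe, ← truncVars_groth_eq_opPerm (by omega : n ≤ N + 1), coeff_truncVars, hc]
  change _ = restrictVars n (stableGroth w) d
  rw [restrictVars]

end Groth

theorem corollaryC (n : ℕ) (w : Equiv.Perm (Fin n)) :
    (∀ d : ℕ →₀ ℕ, ∀ᶠ N in Filter.atTop,
      MvPolynomial.coeff d (Groth.groth (Groth.shiftPerm N w))
        = MvPowerSeries.coeff d (Groth.stableGroth w)) ∧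
    ((Groth.opPerm Groth.piB (Groth.longElt n) (Groth.groth w) : Groth.R) :
        MvPowerSeries ℕ (Polynomial ℤ))
      = Groth.restrictVars n (Groth.stableGroth w) := by
  exact ⟨Groth.eventually_coeff_groth w, Groth.coe_opPerm_groth w⟩
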